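/- Let $\mathcal P$ be a finite projective plane of order $n$ containing a subplane $\mathcal S$ of order $q$ (a set of points and a set of lines of $\mathcal P$ that form a projective plane under the incidence of $\mathcal P$), and suppose that $\mathcal S$ is Desarguesian, i.e. Desargues' theorem holds in $\mathcal S$. Let $\mathcal R$ be any set of cardinality $n$ with two distinct designated elements $0,1$. A coordinatisation of $\mathcal P$ by $\mathcal R$ is obtained as follows. Choose points $O,X,Y,I$, no three collinear, and put $O=(0,0)$, $X=(0)$, $Y=(\infty)$, $I=(1,1)$, $[\infty]=\overline{XY}$, $[0]=\overline{OY}$, $[0,0]=\overline{OX}$, $(0,1)=\overline{XI}\cap[0]$, $(1,0)=\overline{YI}\cap[0,0]$, $(1)=\overline{(1,0)(0,1)}\cap[\infty]$. Label the remaining points of $[0]$ other than $Y$ bijectively, in an arbitrary way, as $(0,a)$ with $a\in\mathcal R\setminus\{0,1\}$. Then put $(a,0)=\overline{(0,a)(1)}\cap[0,0]$, $(a)=\overline{(0,a)(1,0)}\cap[\infty]$, $(a,b)=\overline{(a,0)Y}\cap\overline{(0,b)X}$, $[a]=\overline{(a,0)Y}$ and $[m,k]=\overline{(m)(0,k)}$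 for $a,b,m,k\in\mathcal R$. Let $T(m,x,y)$ be the unique $k\in\mathcal R$ with $(x,y)\in[m,k]$, and set $x\oplus y=T(1,x,y)$ and $x\odot y=T(x,y,0)$. Then $\mathcal P$ has a coordinatisation by $\mathcal R$ for which there is a subset $\mathcal K\subseteq\mathcal R$ of cardinality $q$ that is closed under $\oplus$ and $\odot$ and is a field of order $q$ with $\oplus$ as addition and $\odot$ as multiplication. -/

import Mathlib

namespace Configuration

universe u v w

/-- Three points (of an incidence structure with line type `L`) lie on a common line. -/
def AreCollinear {P : Type u} (L : Type v) [Membership P L] (A B C : P) : Prop :=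
  ∃ l : L, A ∈ l ∧ B ∈ l ∧ C ∈ l

/-- Desargues' theorem holds: whenever two triangles `A B C` and `A' B' C'` are in perspective
from a point `V` (corresponding vertices are distinct, distinct from `V`, and lie on three
different lines `a`, `b`, `c` through `V`), the three intersection points `D`, `E`, `F` of
corresponding sides are collinear. -/
def IsDesarguesian (P : Type u) (L : Type v) [Membership P L] : Prop :=
  ∀ (V A B C A' B' C' D E F : P) (a b c BC CA AB BC' CA' AB' : L),
    ¬ AreCollinear L A B C → ¬ AreCollinear L A' B' C' →
    a ≠ b → b ≠ c → c ≠ a →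
    V ∈ a → V ∈ b → V ∈ c →
    A ∈ a → A' ∈ a → B ∈ b → B' ∈ b → C ∈ c → C' ∈ c →
    A ≠ V → A' ≠ V → B ≠ V → B' ≠ V → C ≠ V → C' ≠ V →
    A ≠ A' → B ≠ B' → C ≠ C' →
    B ∈ BC → C ∈ BC → C ∈ CA → A ∈ CA → A ∈ AB → B ∈ AB →
    B' ∈ BC' → C' ∈ BC' → C' ∈ CA' → A' ∈ CA' → A' ∈ AB' → B' ∈ AB' →
    D ∈ BC → D ∈ BC' → E ∈ CA → E ∈ CA' → F ∈ AB → F ∈ AB' →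
    AreCollinear L D E F

/-- A set of points together with a set of lines. It is a *subplane* if, with the incidence
inherited from the ambient structure, it is a projective plane in its own right, that is, if
there is an instance of `ProjectivePlane S.points S.lines`. -/
structure SubConfiguration (P : Type u) (L : Type v) where
  /-- the chosen points -/
  points : Set P
  /-- the chosen lines -/
  lines : Set L

/-- The incidence relation inherited from the ambient structure. -/
instance SubConfiguration.instMembership {P : Type u} {L : Type v} [Membership P L]
    (S : SubConfiguration P L) : Membership S.points S.lines :=
  ⟨fun l p => (p : P) ∈ (l : L)⟩

/-- A coordinatisation of a plane by a set `R` with two designated elements `0` and `1`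
(and a symbol `∞`). The data are a quadrangle `O, X, Y, I` and an arbitrary labelling
`(0, a)` of the points of the line `OY` other than `Y`; every other label is forced
by the incidence conditions below. -/
structure Coordinatisation (P : Type u) (L : Type v) (R : Type w)
    [Membership P L] [Zero R] [One R] where
  /-- the origin -/
  O : P
  /-- the point `(0)` -/
  X : P
  /-- the point `(∞)` -/
  Y : P
  /-- the unit point -/
  I : P
  not_collinear_OXY : ¬ AreCollinear L O X Y
  not_collinear_OXI : ¬ AreCollinear L O X I
  not_collinear_OYI : ¬ AreCollinear L O Y I
  not_collinear_XYI : ¬ AreCollinear L X Y I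
  /-- the affine point `(a, b)` -/
  pt : R → R → P
  /-- the point `(a)` at infinity -/
  slope : R → P
  /-- the line `[∞]` at infinity -/
  lineInf : L
  /-- the vertical line `[a]` -/
  vert : R → L
  /-- the line `[m, k]` -/
  line : R → R → L
  pt_zero_zero : pt 0 0 = O
  slope_zero : slope 0 = X
  pt_one_one : pt 1 1 = I
  /-- `[∞] = XY` -/
  X_mem_lineInf : X ∈ lineInf
  Y_mem_lineInf : Y ∈ lineInf
  /-- `[0] = OY` -/
  O_mem_vert_zero : O ∈ vert 0
  Y_mem_vert_zero : Y ∈ vert 0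
  /-- `[0, 0] = OX` -/
  O_mem_line_zero_zero : O ∈ line 0 0
  X_mem_line_zero_zero : X ∈ line 0 0
  /-- `(0, 1) = XI ∩ [0]` (membership in `[0]` is part of `bijOn_pt_zero`) -/
  collinear_zero_one : AreCollinear L X I (pt 0 1)
  /-- `(1, 0) = YI ∩ [0, 0]` (membership in `[0, 0]` is part of `pt_zero_mem`) -/
  collinear_one_zero : AreCollinear L Y I (pt 1 0)
  /-- `(1) = (1, 0)(0, 1) ∩ [∞]` (membership in `[∞]` is part of `slope_mem`) -/
  collinear_slope_one : AreCollinear L (pt 1 0) (pt 0 1) (slope 1)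
  /-- the points of `[0]` other than `Y` are labelled bijectively as `(0, a)`, `a ∈ R` -/
  bijOn_pt_zero : Set.BijOn (pt 0) Set.univ {p | p ∈ vert 0 ∧ p ≠ Y}
  /-- `(a, 0) = (0, a)(1) ∩ [0, 0]` -/
  pt_zero_mem : ∀ a, pt a 0 ∈ line 0 0
  collinear_pt_zero : ∀ a, AreCollinear L (pt 0 a) (slope 1) (pt a 0)
  /-- `(a) = (0, a)(1, 0) ∩ [∞]` -/
  slope_mem : ∀ a, slope a ∈ lineInf
  collinear_slope : ∀ a, AreCollinear L (pt 0 a) (pt 1 0) (slope a)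
  /-- `(a, b) = (a, 0)Y ∩ (0, b)X` -/
  collinear_pt_Y : ∀ a b, AreCollinear L (pt a 0) Y (pt a b)
  collinear_pt_X : ∀ a b, AreCollinear L (pt 0 b) X (pt a b)
  /-- `[a] = (a, 0)Y` -/
  pt_mem_vert : ∀ a, pt a 0 ∈ vert a
  Y_mem_vert : ∀ a, Y ∈ vert a
  /-- `[m, k] = (m)(0, k)` -/
  slope_mem_line : ∀ m k, slope m ∈ line m k
  pt_mem_line : ∀ m k, pt 0 k ∈ line m k

namespace Coordinatisation

section

variable {P : Type u} {L : Type v} {R : Type w} [Membership P L] [Zero R] [One R]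

theorem pt_zero_mem_vert (C : Coordinatisation P L R) (a : R) : C.pt 0 a ∈ C.vert 0 :=
  (C.bijOn_pt_zero.mapsTo (Set.mem_univ a)).1

theorem pt_zero_ne_Y (C : Coordinatisation P L R) (a : R) : C.pt 0 a ≠ C.Y :=
  (C.bijOn_pt_zero.mapsTo (Set.mem_univ a)).2

variable [Nondegenerate P L]

theorem eq_of_mem_vert_of_mem_lineInf (C : Coordinatisation P L R) {p : P}
    (h : p ∈ C.vert 0) (h' : p ∈ C.lineInf) : p = C.Y :=
  (Nondegenerate.eq_or_eq h C.Y_mem_vert_zero h' C.Y_mem_lineInf).resolve_right fun e =>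
    C.not_collinear_OXY ⟨C.vert 0, C.O_mem_vert_zero, e ▸ C.X_mem_lineInf, C.Y_mem_vert_zero⟩

theorem eq_of_mem_vert_of_mem_line (C : Coordinatisation P L R) {p : P}
    (h : p ∈ C.vert 0) (h' : p ∈ C.line 0 0) : p = C.O :=
  (Nondegenerate.eq_or_eq h C.O_mem_vert_zero h' C.O_mem_line_zero_zero).resolve_right fun e =>
    C.not_collinear_OXY
      ⟨C.vert 0, C.O_mem_vert_zero, e ▸ C.X_mem_line_zero_zero, C.Y_mem_vert_zero⟩

theorem eq_of_mem_lineInf_of_mem_line (C : Coordinatisation P L R) {p : P}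
    (h : p ∈ C.lineInf) (h' : p ∈ C.line 0 0) : p = C.X :=
  (Nondegenerate.eq_or_eq h C.X_mem_lineInf h' C.X_mem_line_zero_zero).resolve_right fun e =>
    C.not_collinear_OXY
      ⟨C.lineInf, e ▸ C.O_mem_line_zero_zero, C.X_mem_lineInf, C.Y_mem_lineInf⟩

theorem pt_zero_not_mem_lineInf (C : Coordinatisation P L R) (a : R) :
    C.pt 0 a ∉ C.lineInf := fun h =>
  C.pt_zero_ne_Y a (C.eq_of_mem_vert_of_mem_lineInf (C.pt_zero_mem_vert a) h)

theorem slope_not_mem_vert (C : Coordinatisation P L R) (m : R) : C.slope m ∉ C.vert 0 := by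
  intro hm
  have hY := C.eq_of_mem_vert_of_mem_lineInf hm (C.slope_mem m)
  obtain ⟨l, h1, h2, h3⟩ := C.collinear_slope m
  rw [hY] at h3
  have e : l = C.vert 0 := (Nondegenerate.eq_or_eq h1 h3 (C.pt_zero_mem_vert m)
    C.Y_mem_vert_zero).resolve_left (C.pt_zero_ne_Y m)
  rw [e] at h2
  have hO := C.eq_of_mem_vert_of_mem_line h2 (C.pt_zero_mem 1)
  obtain ⟨l', k1, k2, k3⟩ := C.collinear_one_zero
  rw [hO] at k3
  exact C.not_collinear_OYI ⟨l', k3, k1, k2⟩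

theorem slope_one_ne_X (C : Coordinatisation P L R) : C.slope 1 ≠ C.X := by
  intro h
  obtain ⟨l, h1, h2, h3⟩ := C.collinear_slope_one
  rw [h] at h3
  have hne : C.pt 1 0 ≠ C.X := by
    intro e
    obtain ⟨l', k1, k2, k3⟩ := C.collinear_one_zero
    rw [e] at k3
    exact C.not_collinear_XYI ⟨l', k3, k1, k2⟩
  have e : l = C.line 0 0 := (Nondegenerate.eq_or_eq h1 h3 (C.pt_zero_mem 1)
    C.X_mem_line_zero_zero).resolve_left hne
  rw [e] at h2
  have hO := C.eq_of_mem_vert_of_mem_line (C.pt_zero_mem_vert 1) h2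
  obtain ⟨l', k1, k2, k3⟩ := C.collinear_zero_one
  rw [hO] at k3
  exact C.not_collinear_OXI ⟨l', k3, k1, k2⟩

theorem pt_not_mem_lineInf (C : Coordinatisation P L R) (x y : R) :
    C.pt x y ∉ C.lineInf := by
  intro h
  obtain ⟨l, h1, h2, h3⟩ := C.collinear_pt_X x y
  have hX : C.pt x y = C.X := by
    refine (Nondegenerate.eq_or_eq h3 h2 h C.X_mem_lineInf).resolve_right fun e => ?_
    rw [e] at h1
    exact C.pt_zero_not_mem_lineInf y h1
  obtain ⟨l', k1, k2, k3⟩ := C.collinear_pt_Y x y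
  rw [hX] at k3
  have hXY : C.X ≠ C.Y := fun e =>
    C.not_collinear_OXY ⟨C.vert 0, C.O_mem_vert_zero, e ▸ C.Y_mem_vert_zero, C.Y_mem_vert_zero⟩
  have e : l' = C.lineInf := (Nondegenerate.eq_or_eq k3 k2 C.X_mem_lineInf
    C.Y_mem_lineInf).resolve_left hXY
  rw [e] at k1
  have hx := C.eq_of_mem_lineInf_of_mem_line k1 (C.pt_zero_mem x)
  obtain ⟨l'', j1, j2, j3⟩ := C.collinear_pt_zero x
  rw [hx] at j3
  have e' : l'' = C.lineInf := (Nondegenerate.eq_or_eq j2 j3 (C.slope_mem 1)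
    C.X_mem_lineInf).resolve_left C.slope_one_ne_X
  rw [e'] at j1
  exact C.pt_zero_not_mem_lineInf x j1

end

variable {P : Type u} {L : Type v} {R : Type w} [Membership P L] [ProjectivePlane P L]
  [Zero R] [One R]

/-- For all `m, x, y` there is exactly one `k` such that `(x, y)` lies on `[m, k]`. -/
theorem existsUnique_pt_mem_line (C : Coordinatisation P L R) (m x y : R) :
    ∃! k, C.pt x y ∈ C.line m k := by
  have hne : C.slope m ≠ C.pt x y := fun e => C.pt_not_mem_lineInf x y (e ▸ C.slope_mem m)
  obtain ⟨l, ⟨hl1, hl2⟩, -⟩ := HasLines.existsUnique_line P L _ _ hne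
  have hlv : l ≠ C.vert 0 := fun e => C.slope_not_mem_vert m (e ▸ hl1)
  obtain ⟨p, ⟨hp1, hp2⟩, -⟩ := HasPoints.existsUnique_point P L _ _ hlv
  have hpY : p ≠ C.Y := by
    rintro rfl
    have hs : C.slope m ≠ C.Y := fun e => C.slope_not_mem_vert m (e ▸ C.Y_mem_vert_zero)
    have e : l = C.lineInf := (Nondegenerate.eq_or_eq hl1 hp1 (C.slope_mem m)
      C.Y_mem_lineInf).resolve_left hs
    exact C.pt_not_mem_lineInf x y (e ▸ hl2)
  obtain ⟨k, -, rfl⟩ := C.bijOn_pt_zero.surjOn ⟨hp2, hpY⟩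
  have hsk : ∀ k, C.slope m ≠ C.pt 0 k := fun k e =>
    C.slope_not_mem_vert m (e ▸ C.pt_zero_mem_vert k)
  have key : ∀ k, C.pt 0 k ∈ l → C.line m k = l := fun k hk =>
    (Nondegenerate.eq_or_eq (C.slope_mem_line m k) (C.pt_mem_line m k) hl1 hk).resolve_left
      (hsk k)
  refine ⟨k, by simpa only [key k hp1] using hl2, fun k' hk' => ?_⟩
  have e : C.line m k' = l :=
    (Nondegenerate.eq_or_eq (C.slope_mem_line m k') hk' hl1 hl2).resolve_left hne
  refine C.bijOn_pt_zero.injOn (Set.mem_univ _) (Set.mem_univ _) ?_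
  exact (Nondegenerate.eq_or_eq (e ▸ C.pt_mem_line m k') hp1 (C.pt_zero_mem_vert k')
    hp2).resolve_right hlv

/-- The planar ternary ring of a coordinatisation: `T(m, x, y)` is the unique `k` such that
the point `(x, y)` lies on the line `[m, k]`. -/
noncomputable def ptr (C : Coordinatisation P L R) (m x y : R) : R :=
  (C.existsUnique_pt_mem_line m x y).choose

theorem ptr_eq_iff (C : Coordinatisation P L R) (m x y k : R) :
    C.ptr m x y = k ↔ C.pt x y ∈ C.line m k :=
  ⟨fun h => h ▸ (C.existsUnique_pt_mem_line m x y).choose_spec.1,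
    fun h => ((C.existsUnique_pt_mem_line m x y).choose_spec.2 k h).symm⟩

/-- `x ⊕ y = T(1, x, y)` -/
noncomputable def oplus (C : Coordinatisation P L R) (x y : R) : R := C.ptr 1 x y

/-- `x ⊙ y = T(x, y, 0)` -/
noncomputable def odot (C : Coordinatisation P L R) (x y : R) : R := C.ptr x y 0

end Coordinatisation

end Configuration

namespace Configuration

universe u v w

section Plane

variable {P : Type u} {L : Type v} [Membership P L]

theorem line_eq_of_mem [Nondegenerate P L] {p q : P} {l m : L} (hpq : p ≠ q) (hp : p ∈ l)
    (hq : q ∈ l) (hp' : p ∈ m) (hq' : q ∈ m) : l = m :=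
  (Nondegenerate.eq_or_eq hp hq hp' hq').resolve_left hpq

theorem point_eq_of_mem [Nondegenerate P L] {p q : P} {l m : L} (hlm : l ≠ m) (hp : p ∈ l)
    (hq : q ∈ l) (hp' : p ∈ m) (hq' : q ∈ m) : p = q :=
  (Nondegenerate.eq_or_eq hp hq hp' hq').resolve_right hlm

theorem AreCollinear.mem_of_ne [Nondegenerate P L] {A B D : P} {l : L}
    (h : AreCollinear L A B D) (hAB : A ≠ B) (hA : A ∈ l) (hB : B ∈ l) : D ∈ l := by
  obtain ⟨m, h1, h2, h3⟩ := h
  exact line_eq_of_mem hAB h1 h2 hA hB ▸ h3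

theorem exists_line_through [ProjectivePlane P L] (p q : P) : ∃ l : L, p ∈ l ∧ q ∈ l := by
  by_cases h : p = q
  · obtain ⟨r, hr⟩ : ∃ r : P, p ≠ r := by
      obtain ⟨p₁, p₂, p₃, l₁, l₂, l₃, h1, -, -, h2, -⟩ :=
        ProjectivePlane.exists_config (P := P) (L := L)
      by_contra! hc
      exact h1 (hc p₁ ▸ hc p₂ ▸ h2)
    obtain ⟨l, hl, -⟩ := HasLines.existsUnique_line P L _ _ hr
    exact ⟨l, hl.1, h ▸ hl.1⟩
  · exact (HasLines.existsUnique_line P L _ _ h).exists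

theorem exists_mem_inter [ProjectivePlane P L] (l m : L) : ∃ p : P, p ∈ l ∧ p ∈ m := by
  by_cases h : l = m
  · obtain ⟨r, hr⟩ : ∃ r : L, l ≠ r := by
      obtain ⟨p₁, p₂, p₃, l₁, l₂, l₃, h1, -, h3, h2, h4, -⟩ :=
        ProjectivePlane.exists_config (P := P) (L := L)
      by_contra! hc
      exact h3 (hc l₁ ▸ hc l₂ ▸ h2)
    obtain ⟨p, hp, -⟩ := HasPoints.existsUnique_point P L _ _ hr
    exact ⟨p, hp.1, h ▸ hp.1⟩
  · exact (HasPoints.existsUnique_point P L _ _ h).exists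

/-- Desargues' theorem when two pairs of corresponding sides are known to meet on the line `r`:
the third pair of corresponding sides meets on `r` as well. -/
theorem IsDesarguesian.mem_of_mem_axis [ProjectivePlane P L] (hD : IsDesarguesian P L)
    {V A B C A' B' C' D E F : P} {a b c BC CA AB BC' CA' AB' r : L}
    (hab : a ≠ b) (hbc : b ≠ c) (hca : c ≠ a)
    (hVa : V ∈ a) (hVb : V ∈ b) (hVc : V ∈ c)
    (hA : A ∈ a) (hA' : A' ∈ a) (hB : B ∈ b) (hB' : B' ∈ b) (hC : C ∈ c) (hC' : C' ∈ c)
    (hAV : A ≠ V) (hAV' : A' ≠ V) (hBV : B ≠ V) (hBV' : B' ≠ V) (hCV : C ≠ V) (hCV' : C' ≠ V)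
    (hAA : A ≠ A') (hBB : B ≠ B') (hCC : C ≠ C')
    (hBBC : B ∈ BC) (hCBC : C ∈ BC) (hCCA : C ∈ CA) (hACA : A ∈ CA) (hAAB : A ∈ AB)
    (hBAB : B ∈ AB)
    (hBBC' : B' ∈ BC') (hCBC' : C' ∈ BC') (hCCA' : C' ∈ CA') (hACA' : A' ∈ CA')
    (hAAB' : A' ∈ AB') (hBAB' : B' ∈ AB')
    (hE : E ∈ CA) (hE' : E ∈ CA') (hEr : E ∈ r) (hF : F ∈ AB) (hF' : F ∈ AB') (hFr : F ∈ r)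
    (hEF : E ≠ F) (hAr : A ∉ r) (hAr' : A' ∉ r) (hBr : B ∉ r)
    (hDBC : D ∈ BC) (hDr : D ∈ r) : D ∈ BC' := by
  have ne : ∀ {p q : P} {l m : L}, l ≠ m → V ∈ l → V ∈ m → p ∈ l → q ∈ m → p ≠ V → p ≠ q := by
    rintro p q l m hlm hl hm hp hq hpV rfl
    exact hpV (point_eq_of_mem hlm hp hl hq hm)
  have key : ∀ {A B C : P} {CA AB : L}, A ∈ a → B ∈ b → C ∈ c → A ≠ V → C ≠ V → C ∈ CA →
      A ∈ CA → A ∈ AB → B ∈ AB → E ∈ CA → F ∈ AB → A ∉ r → ¬ AreCollinear L A B C := by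
    rintro A B C CA AB hA hB hC hAV hCV h1 h2 h3 h4 hE hF hAr ⟨l, hl1, hl2, hl3⟩
    have e1 : CA = l := line_eq_of_mem (ne hca hVc hVa hC hA hCV) h1 h2 hl3 hl1
    have e2 : AB = l := line_eq_of_mem (ne hab hVa hVb hA hB hAV) h3 h4 hl1 hl2
    subst e1 e2
    exact hAr (line_eq_of_mem hEF hE hF hEr hFr ▸ h2)
  obtain ⟨D', h1, h2⟩ := exists_mem_inter (P := P) BC BC'
  have hcol := hD V A B C A' B' C' D' E F a b c BC CA AB BC' CA' AB'
    (key hA hB hC hAV hCV hCCA hACA hAAB hBAB hE hF hAr)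
    (key hA' hB' hC' hAV' hCV' hCCA' hACA' hAAB' hBAB' hE' hF' hAr')
    hab hbc hca hVa hVb hVc hA hA' hB hB' hC hC' hAV hAV' hBV hBV' hCV hCV' hAA hBB hCC
    hBBC hCBC hCCA hACA hAAB hBAB hBBC' hCBC' hCCA' hACA' hAAB' hBAB' h1 h2 hE hE' hF hF'
  obtain ⟨l, hl1, hl2, hl3⟩ := hcol
  have hD' : D' ∈ r := line_eq_of_mem hEF hl2 hl3 hEr hFr ▸ hl1
  have hBCr : BC ≠ r := by
    rintro rfl
    exact hBr hBBC
  exact point_eq_of_mem hBCr hDBC h1 hDr hD' ▸ h2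

end Plane

namespace Coordinatisation

theorem zero_ne_one {P : Type u} {L : Type v} {R : Type w} [Membership P L] [Zero R] [One R]
    (C : Coordinatisation P L R) : (0 : R) ≠ 1 := fun h => C.not_collinear_OXI <| by
  have hOI : C.O = C.I := by rw [← C.pt_zero_zero, ← C.pt_one_one, ← h]
  exact ⟨C.line 0 0, C.O_mem_line_zero_zero, C.X_mem_line_zero_zero,
    hOI ▸ C.O_mem_line_zero_zero⟩

variable {P : Type u} {L : Type v} {R : Type w} [Membership P L] [ProjectivePlane P L]
  [Zero R] [One R] (C : Coordinatisation P L R)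

theorem pt_ne_slope (x y m : R) : C.pt x y ≠ C.slope m := fun h =>
  C.pt_not_mem_lineInf x y (h ▸ C.slope_mem m)

theorem pt_ne_Y (x y : R) : C.pt x y ≠ C.Y := fun h =>
  C.pt_not_mem_lineInf x y (h ▸ C.Y_mem_lineInf)

theorem slope_ne_Y (m : R) : C.slope m ≠ C.Y := fun h =>
  C.slope_not_mem_vert m (h ▸ C.Y_mem_vert_zero)

theorem pt_mem_vert_self (x y : R) : C.pt x y ∈ C.vert x :=
  (C.collinear_pt_Y x y).mem_of_ne (C.pt_ne_Y x 0) (C.pt_mem_vert x) (C.Y_mem_vert x)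

theorem line_ne_lineInf (m k : R) : C.line m k ≠ C.lineInf := fun h =>
  C.pt_not_mem_lineInf 0 k (h ▸ C.pt_mem_line m k)

theorem vert_ne_lineInf (x : R) : C.vert x ≠ C.lineInf := fun h =>
  C.pt_not_mem_lineInf x 0 (h ▸ C.pt_mem_vert x)

theorem Y_not_mem_line (m k : R) : C.Y ∉ C.line m k := fun h =>
  C.slope_ne_Y m (point_eq_of_mem (C.line_ne_lineInf m k) (C.slope_mem_line m k) h
    (C.slope_mem m) C.Y_mem_lineInf)

theorem line_ne_vert (m k x : R) : C.line m k ≠ C.vert x := fun h =>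
  C.Y_not_mem_line m k (h ▸ C.Y_mem_vert x)

theorem ptr_zero_left (x y : R) : C.ptr 0 x y = y := by
  rw [ptr_eq_iff]
  exact (C.collinear_pt_X x y).mem_of_ne (C.slope_zero ▸ C.pt_ne_slope 0 y 0)
    (C.pt_mem_line 0 y) (C.slope_zero ▸ C.slope_mem_line 0 y)

theorem ptr_zero_mid (m y : R) : C.ptr m 0 y = y := by
  rw [ptr_eq_iff]
  exact C.pt_mem_line m y

theorem ptr_one_left (x : R) : C.ptr 1 x 0 = x := by
  rw [ptr_eq_iff]
  exact (C.collinear_pt_zero x).mem_of_ne (C.pt_ne_slope 0 x 1)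
    (C.pt_mem_line 1 x) (C.slope_mem_line 1 x)

theorem pt_zero_mem_line_iff {m k y : R} : C.pt 0 y ∈ C.line m k ↔ y = k := by
  rw [← ptr_eq_iff, ptr_zero_mid]

theorem vert_injective {x x' y y' : R} (h : C.pt x y = C.pt x' y') : x = x' := by
  have e : C.vert x = C.vert x' := line_eq_of_mem (C.pt_ne_Y x y) (C.pt_mem_vert_self x y)
    (C.Y_mem_vert x) (h ▸ C.pt_mem_vert_self x' y') (C.Y_mem_vert x')
  have h0 : C.pt x 0 = C.pt x' 0 := point_eq_of_mem (C.line_ne_vert 0 0 x) (C.pt_zero_mem x)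
    (C.pt_zero_mem x') (C.pt_mem_vert x) (e ▸ C.pt_mem_vert x')
  rw [← C.ptr_one_left x, ← C.ptr_one_left x', ptr_eq_iff, h0, ← ptr_eq_iff]

theorem pt_inj {x x' y y' : R} (h : C.pt x y = C.pt x' y') : x = x' ∧ y = y' := by
  refine ⟨C.vert_injective h, ?_⟩
  rw [← C.ptr_zero_left x y, ← C.ptr_zero_left x' y', ptr_eq_iff, h, ← ptr_eq_iff]

theorem pt_mem_vert_iff {x y z : R} : C.pt x y ∈ C.vert z ↔ x = z := by
  refine ⟨fun h => ?_, fun h => h ▸ C.pt_mem_vert_self x y⟩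
  have e : C.vert x = C.vert z := line_eq_of_mem (C.pt_ne_Y x y) (C.pt_mem_vert_self x y)
    (C.Y_mem_vert x) h (C.Y_mem_vert z)
  have h0 : C.pt x 0 = C.pt z 0 := point_eq_of_mem (C.line_ne_vert 0 0 x) (C.pt_zero_mem x)
    (C.pt_zero_mem z) (C.pt_mem_vert x) (e ▸ C.pt_mem_vert z)
  exact C.vert_injective h0

theorem vert_ne_vert {x x' : R} (h : x ≠ x') : C.vert x ≠ C.vert x' := fun e =>
  h (C.pt_mem_vert_iff.1 (e ▸ C.pt_mem_vert x))

theorem ptr_one_mid (m : R) : C.ptr m 1 0 = m := by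
  rw [ptr_eq_iff]
  have h1 : C.pt 0 m ≠ C.pt 1 0 := fun h => C.zero_ne_one (C.vert_injective h)
  obtain ⟨l, h2, h3, h4⟩ := C.collinear_slope m
  exact line_eq_of_mem (C.pt_ne_slope 0 m m) h2 h4 (C.pt_mem_line m m) (C.slope_mem_line m m)
    ▸ h3

theorem slope_injective : Function.Injective C.slope := by
  intro m m' h
  have h1 : C.pt 1 0 ∈ C.line m m := (C.ptr_eq_iff _ _ _ _).1 (C.ptr_one_mid m)
  have h2 : C.pt 1 0 ∈ C.line m' m' := (C.ptr_eq_iff _ _ _ _).1 (C.ptr_one_mid m')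
  have e : C.line m m = C.line m' m' := line_eq_of_mem (C.pt_ne_slope 1 0 m) h1
    (C.slope_mem_line m m) h2 (h ▸ C.slope_mem_line m' m')
  exact C.pt_zero_mem_line_iff.1 (e ▸ C.pt_mem_line m m)

theorem slope_mem_line_iff {m m' k : R} : C.slope m ∈ C.line m' k ↔ m = m' := by
  refine ⟨fun h => C.slope_injective ?_, fun h => h ▸ C.slope_mem_line m k⟩
  exact point_eq_of_mem (C.line_ne_lineInf m' k) h (C.slope_mem_line m' k) (C.slope_mem m)
    (C.slope_mem m')

theorem line_ne_line_of_slope {m m' : R} (h : m ≠ m') (k k' : R) :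
    C.line m k ≠ C.line m' k' := fun e =>
  h (C.slope_mem_line_iff.1 (e ▸ C.slope_mem_line m k))

theorem line_ne_line_of_const {k k' : R} (h : k ≠ k') (m m' : R) :
    C.line m k ≠ C.line m' k' := fun e =>
  h (C.pt_zero_mem_line_iff.1 (e ▸ C.pt_mem_line m k))

theorem ptr_right_injective (m x : R) : Function.Injective (C.ptr m x) := by
  intro y y' h
  exact (C.pt_inj (point_eq_of_mem (C.line_ne_vert m (C.ptr m x y') x)
    ((C.ptr_eq_iff _ _ _ _).1 h) ((C.ptr_eq_iff _ _ _ _).1 rfl) (C.pt_mem_vert_self x y)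
    (C.pt_mem_vert_self x y'))).2

theorem eq_and_eq_of_ptr_eq {m m' x y x' y' : R} (hm : m ≠ m')
    (h : C.ptr m x y = C.ptr m x' y') (h' : C.ptr m' x y = C.ptr m' x' y') :
    x = x' ∧ y = y' :=
  C.pt_inj (point_eq_of_mem (C.line_ne_line_of_slope hm _ _) ((C.ptr_eq_iff _ _ _ _).1 h)
    ((C.ptr_eq_iff _ _ _ _).1 rfl) ((C.ptr_eq_iff _ _ _ _).1 h') ((C.ptr_eq_iff _ _ _ _).1 rfl))

theorem ptr_mid_injective {m : R} (hm : m ≠ 0) (y : R) :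
    Function.Injective fun x => C.ptr m x y := fun x x' h =>
  (C.eq_and_eq_of_ptr_eq hm h (by rw [ptr_zero_left, ptr_zero_left])).1

theorem ptr_left_injective {x : R} (hx : x ≠ 0) (y : R) :
    Function.Injective fun m => C.ptr m x y := by
  intro m m' h
  by_contra hm
  exact hx (C.eq_and_eq_of_ptr_eq (x' := 0) (y' := C.ptr m x y) hm
    (by rw [ptr_zero_mid]) (by rw [ptr_zero_mid]; exact h.symm)).1

theorem exists_slope_eq {p : P} (hp : p ∈ C.lineInf) (hpY : p ≠ C.Y) : ∃ m, C.slope m = p := by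
  obtain ⟨l, hl1, hl2⟩ := exists_line_through (L := L) p (C.pt 1 0)
  obtain ⟨r, hr1, hr2⟩ := exists_mem_inter (P := P) l (C.vert 0)
  have hl : l ≠ C.lineInf := fun h => C.pt_not_mem_lineInf 1 0 (h ▸ hl2)
  have hrY : r ≠ C.Y := by
    rintro rfl
    exact hpY (point_eq_of_mem hl hl1 hr1 hp C.Y_mem_lineInf)
  obtain ⟨m, -, rfl⟩ := C.bijOn_pt_zero.surjOn ⟨hr2, hrY⟩
  refine ⟨m, point_eq_of_mem hl ?_ hl1 (C.slope_mem m) hp⟩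
  exact (C.collinear_slope m).mem_of_ne (fun h => C.zero_ne_one (C.vert_injective h)) hr1 hl2

theorem exists_ptr_eq {x x' : R} (hx : x ≠ x') (y y' : R) :
    ∃ m, C.ptr m x y = C.ptr m x' y' := by
  obtain ⟨l, hl1, hl2⟩ := exists_line_through (L := L) (C.pt x y) (C.pt x' y')
  obtain ⟨p, hp1, hp2⟩ := exists_mem_inter (P := P) l C.lineInf
  have hpY : p ≠ C.Y := by
    rintro rfl
    have : l = C.vert x := line_eq_of_mem (C.pt_ne_Y x y) hl1 hp1 (C.pt_mem_vert_self x y)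
      (C.Y_mem_vert x)
    exact hx (C.pt_mem_vert_iff.1 (this ▸ hl2)).symm
  obtain ⟨m, rfl⟩ := C.exists_slope_eq hp2 hpY
  refine ⟨m, ?_⟩
  rw [ptr_eq_iff]
  have : l = C.line m (C.ptr m x' y') := line_eq_of_mem (C.pt_ne_slope x' y' m) hl2 hp1
    ((C.ptr_eq_iff _ _ _ _).1 rfl) (C.slope_mem_line _ _)
  exact this ▸ hl1

end Coordinatisation

namespace Coordinatisation

variable {P : Type u} {L : Type v} {R : Type w} [Membership P L] [ProjectivePlane P L]
  [Zero R] [One R] (C : Coordinatisation P L R)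

theorem pt_mem_line_iff {m k x y : R} : C.pt x y ∈ C.line m k ↔ C.ptr m x y = k :=
  (C.ptr_eq_iff m x y k).symm

theorem pt_mem_line_self (m x y : R) : C.pt x y ∈ C.line m (C.ptr m x y) :=
  C.pt_mem_line_iff.2 rfl

theorem pt_ne_of_fst {x x' : R} (h : x ≠ x') (y y' : R) : C.pt x y ≠ C.pt x' y' := fun e =>
  h (C.pt_inj e).1

theorem pt_ne_of_snd {y y' : R} (h : y ≠ y') (x x' : R) : C.pt x y ≠ C.pt x' y' := fun e =>
  h (C.pt_inj e).2

/-- Desargues' theorem with axis the line at infinity: if two triangles are in perspective and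
two pairs of corresponding sides are parallel, then so is the third pair. -/
theorem ptr_eq_of_perspective (hD : IsDesarguesian P L) {V E F : P} {a b c CA AB CA' AB' : L}
    {x₁ y₁ x₂ y₂ x₃ y₃ x₁' y₁' x₂' y₂' x₃' y₃' d : R}
    (hab : a ≠ b) (hbc : b ≠ c) (hca : c ≠ a) (hVa : V ∈ a) (hVb : V ∈ b) (hVc : V ∈ c)
    (hA : C.pt x₁ y₁ ∈ a) (hA' : C.pt x₁' y₁' ∈ a) (hB : C.pt x₂ y₂ ∈ b) (hB' : C.pt x₂' y₂' ∈ b)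
    (hC : C.pt x₃ y₃ ∈ c) (hC' : C.pt x₃' y₃' ∈ c)
    (hAV : C.pt x₁ y₁ ≠ V) (hAV' : C.pt x₁' y₁' ≠ V) (hBV : C.pt x₂ y₂ ≠ V)
    (hBV' : C.pt x₂' y₂' ≠ V) (hCV : C.pt x₃ y₃ ≠ V) (hCV' : C.pt x₃' y₃' ≠ V)
    (hAA : C.pt x₁ y₁ ≠ C.pt x₁' y₁') (hBB : C.pt x₂ y₂ ≠ C.pt x₂' y₂')
    (hCC : C.pt x₃ y₃ ≠ C.pt x₃' y₃')
    (hCCA : C.pt x₃ y₃ ∈ CA) (hACA : C.pt x₁ y₁ ∈ CA) (hECA : E ∈ CA)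
    (hCCA' : C.pt x₃' y₃' ∈ CA') (hACA' : C.pt x₁' y₁' ∈ CA') (hECA' : E ∈ CA')
    (hAAB : C.pt x₁ y₁ ∈ AB) (hBAB : C.pt x₂ y₂ ∈ AB) (hFAB : F ∈ AB)
    (hAAB' : C.pt x₁' y₁' ∈ AB') (hBAB' : C.pt x₂' y₂' ∈ AB') (hFAB' : F ∈ AB')
    (hE : E ∈ C.lineInf) (hF : F ∈ C.lineInf) (hEF : E ≠ F)
    (hx : x₂' ≠ x₃') (hd : C.ptr d x₂ y₂ = C.ptr d x₃ y₃) :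
    C.ptr d x₂' y₂' = C.ptr d x₃' y₃' := by
  obtain ⟨p, hp⟩ := C.exists_ptr_eq hx y₂' y₃'
  have := hD.mem_of_mem_axis hab hbc hca hVa hVb hVc hA hA' hB hB' hC hC' hAV hAV' hBV hBV' hCV
    hCV' hAA hBB hCC (C.pt_mem_line_iff.2 hd) (C.pt_mem_line_self d x₃ y₃) hCCA hACA hAAB hBAB
    (C.pt_mem_line_iff.2 hp) (C.pt_mem_line_self p x₃' y₃') hCCA' hACA' hAAB' hBAB' hECA hECA' hE
    hFAB hFAB' hF hEF (C.pt_not_mem_lineInf _ _) (C.pt_not_mem_lineInf _ _)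
    (C.pt_not_mem_lineInf _ _) (C.slope_mem_line d _) (C.slope_mem d)
  rwa [C.slope_mem_line_iff.1 this]

/-- A translation along the vertical lines that preserves the directions of two sides of a
triangle preserves the direction of the third. -/
theorem ptr_eq_of_vertical_translation (hD : IsDesarguesian P L)
    {x₁ x₂ x₃ y₁ y₂ y₃ y₁' y₂' y₃' m n d : R}
    (h12 : C.ptr m x₁ y₁ = C.ptr m x₂ y₂) (h12' : C.ptr m x₁ y₁' = C.ptr m x₂ y₂')
    (h23 : C.ptr n x₂ y₂ = C.ptr n x₃ y₃) (h23' : C.ptr n x₂ y₂' = C.ptr n x₃ y₃')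
    (h13 : C.ptr d x₁ y₁ = C.ptr d x₃ y₃) (hx : x₁ ≠ x₃) :
    C.ptr d x₁ y₁' = C.ptr d x₃ y₃' := by
  have trans : ∀ {x x' y y' z z' m : R}, C.ptr m x y = C.ptr m x' y' →
      C.ptr m x z = C.ptr m x' z' → y = z → y' = z' := by
    rintro x x' y y' z z' m h h' rfl
    exact C.ptr_right_injective m x' (h.symm.trans h')
  have trans' : ∀ {x x' y y' z z' m : R}, C.ptr m x y = C.ptr m x' y' →
      C.ptr m x z = C.ptr m x' z' → y' = z' → y = z := fun h h' => trans h.symm h'.symm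
  by_cases hy : y₂ = y₂'
  · obtain rfl := hy
    obtain rfl := trans' h12 h12' rfl
    obtain rfl := trans h23 h23' rfl
    exact h13
  have hy1 : y₁ ≠ y₁' := fun h => hy (trans h12 h12' h)
  have hy3 : y₃ ≠ y₃' := fun h => hy (trans' h23 h23' h)
  by_cases hmn : m = n
  · obtain rfl := hmn
    have hdm : d = m := by
      by_contra hdm
      exact hx (C.eq_and_eq_of_ptr_eq hdm h13 (h12.trans h23)).1
    rw [hdm, h12', h23']
  by_cases hx12 : x₁ = x₂
  · obtain rfl := hx12
    obtain rfl := C.ptr_right_injective m x₁ h12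
    obtain rfl := C.ptr_right_injective m x₁ h12'
    have hdn : d = n := by
      by_contra hdn
      exact hx (C.eq_and_eq_of_ptr_eq hdn h13 h23).1
    rw [hdn, h23']
  by_cases hx23 : x₂ = x₃
  · obtain rfl := hx23
    obtain rfl := C.ptr_right_injective n x₂ h23
    obtain rfl := C.ptr_right_injective n x₂ h23'
    have hdn : d = m := by
      by_contra hdn
      exact hx (C.eq_and_eq_of_ptr_eq hdn h13 h12).1
    rw [hdn, h12']
  exact C.ptr_eq_of_perspective hD (x₁ := x₂) (y₁ := y₂) (x₁' := x₂) (y₁' := y₂')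
    (C.vert_ne_vert (Ne.symm hx12)) (C.vert_ne_vert hx) (C.vert_ne_vert (Ne.symm hx23))
    (C.Y_mem_vert _) (C.Y_mem_vert _) (C.Y_mem_vert _)
    (C.pt_mem_vert_self _ _) (C.pt_mem_vert_self _ _) (C.pt_mem_vert_self _ _)
    (C.pt_mem_vert_self _ _) (C.pt_mem_vert_self _ _) (C.pt_mem_vert_self _ _)
    (C.pt_ne_Y _ _) (C.pt_ne_Y _ _) (C.pt_ne_Y _ _) (C.pt_ne_Y _ _) (C.pt_ne_Y _ _)
    (C.pt_ne_Y _ _) (C.pt_ne_of_snd hy _ _) (C.pt_ne_of_snd hy1 _ _) (C.pt_ne_of_snd hy3 _ _)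
    (C.pt_mem_line_self n _ _) (C.pt_mem_line_iff.2 h23) (C.slope_mem_line n _)
    (C.pt_mem_line_self n _ _) (C.pt_mem_line_iff.2 h23') (C.slope_mem_line n _)
    (C.pt_mem_line_iff.2 h12.symm) (C.pt_mem_line_self m _ _) (C.slope_mem_line m _)
    (C.pt_mem_line_iff.2 h12'.symm) (C.pt_mem_line_self m _ _) (C.slope_mem_line m _)
    (C.slope_mem n) (C.slope_mem m) (fun h => hmn (C.slope_injective h).symm) hx h13

theorem oplus_zero (x : R) : C.oplus x 0 = x := C.ptr_one_left x

theorem zero_oplus (x : R) : C.oplus 0 x = x := C.ptr_zero_mid 1 x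

theorem zero_odot (x : R) : C.odot 0 x = 0 := C.ptr_zero_left x 0

theorem odot_zero (x : R) : C.odot x 0 = 0 := C.ptr_zero_mid x 0

theorem one_odot (x : R) : C.odot 1 x = x := C.ptr_one_left x

theorem odot_one (x : R) : C.odot x 1 = x := C.ptr_one_mid x

theorem oplus_left_cancel {x y z : R} (h : C.oplus x y = C.oplus x z) : y = z :=
  C.ptr_right_injective 1 x h

theorem oplus_right_cancel {x y z : R} (h : C.oplus x z = C.oplus y z) : x = y :=
  C.ptr_mid_injective C.zero_ne_one.symm z h

theorem odot_left_cancel {x y z : R} (hx : x ≠ 0) (h : C.odot x y = C.odot x z) : y = z :=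
  C.ptr_mid_injective hx 0 h

theorem odot_right_cancel {x y z : R} (hz : z ≠ 0) (h : C.odot x z = C.odot y z) : x = y :=
  C.ptr_left_injective hz 0 h

theorem odot_ne_zero {x y : R} (hx : x ≠ 0) (hy : y ≠ 0) : C.odot x y ≠ 0 := fun h =>
  hy (C.odot_left_cancel hx (h.trans (C.odot_zero x).symm))

/-- Linearity of the ternary ring: `T(m, x, y) = (m ⊙ x) ⊕ y`. -/
theorem ptr_eq_oplus_odot (hD : IsDesarguesian P L) (m x y : R) :
    C.ptr m x y = C.oplus (C.odot m x) y := by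
  by_cases hx : x = 0
  · rw [hx, odot_zero, zero_oplus, ptr_zero_mid]
  have := C.ptr_eq_of_vertical_translation hD (x₁ := x) (x₂ := C.odot m x) (x₃ := 0)
    (y₁ := 0) (y₂ := 0) (y₃ := C.odot m x) (y₁' := y) (y₂' := y)
    (y₃' := C.oplus (C.odot m x) y) (m := 0) (n := 1) (d := m)
    (by simp only [ptr_zero_left]) (by simp only [ptr_zero_left])
    (by rw [ptr_zero_mid, ptr_one_left]) (by rw [ptr_zero_mid]; rfl)
    (by rw [ptr_zero_mid]; rfl) hx
  rw [this, ptr_zero_mid]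

theorem exists_odot_eq [Finite R] {x : R} (hx : x ≠ 0) (y : R) : ∃ m, C.odot m x = y :=
  Finite.surjective_of_injective (C.ptr_left_injective hx 0) y

theorem exists_oplus_eq_zero [Finite R] (x : R) : ∃ y, C.oplus y x = 0 :=
  Finite.surjective_of_injective (C.ptr_mid_injective C.zero_ne_one.symm x) 0

/-- Vertical translations preserve the direction of a line. -/
theorem ptr_oplus_eq [Finite R] (hD : IsDesarguesian P L) {m x y t : R}
    (h : C.ptr m t 0 = C.ptr m x y) (c : R) : C.ptr m t c = C.ptr m x (C.oplus y c) := by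
  have main : ∀ {m t : R}, t ≠ 0 → C.ptr m t 0 = C.ptr m x y →
      C.ptr m t c = C.ptr m x (C.oplus y c) := by
    intro m t ht h
    by_cases htx : t = x
    · obtain rfl := htx
      rw [← C.ptr_right_injective m t h, zero_oplus]
    obtain ⟨n, hn⟩ := C.exists_odot_eq ht y
    refine C.ptr_eq_of_vertical_translation hD (x₁ := t) (x₂ := 0) (x₃ := x)
      (y₁ := 0) (y₂ := y) (y₃ := y) (y₁' := c) (y₂' := C.oplus y c) (m := n) (n := 0) (d := m)
      ?_ ?_ (by simp only [ptr_zero_left]) (by simp only [ptr_zero_left]) h htx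
    · rw [ptr_zero_mid]
      exact hn
    · rw [ptr_zero_mid, ptr_eq_oplus_odot C hD, hn]
  by_cases ht : t = 0
  swap
  · exact main ht h
  obtain rfl := ht
  by_cases hx : x = 0
  · obtain rfl := hx
    rw [← C.ptr_right_injective m 0 h, zero_oplus]
  by_cases hq : ∃ s : R, s ≠ 0 ∧ s ≠ x
  · obtain ⟨s, hs0, hsx⟩ := hq
    obtain ⟨p, hp⟩ := C.exists_ptr_eq hsx 0 y
    exact C.ptr_eq_of_vertical_translation hD (x₁ := 0) (x₂ := s) (x₃ := x)
      (y₁ := 0) (y₂ := 0) (y₃ := y) (y₁' := c) (y₂' := c) (m := 0) (n := p) (d := m)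
      (by simp only [ptr_zero_left]) (by simp only [ptr_zero_left]) hp (main hs0 hp) h
      (Ne.symm hx)
  · push Not at hq
    obtain rfl : 1 = x := hq 1 C.zero_ne_one.symm
    have two : ∀ s : R, s = 0 ∨ s = 1 := fun s => or_iff_not_imp_left.2 (hq s)
    rw [ptr_zero_mid] at h ⊢
    rcases two c with rfl | rfl
    · rw [oplus_zero, h]
    rcases two m with rfl | rfl
    · rw [ptr_zero_left] at h ⊢
      rw [← h, zero_oplus]
    rcases two y with rfl | rfl
    · rw [ptr_one_left] at h
      exact absurd h C.zero_ne_one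
    · have h11 : C.oplus 1 1 = 0 := h.symm
      rw [h11, ptr_one_left]

theorem oplus_assoc [Finite R] (hD : IsDesarguesian P L) (x y z : R) :
    C.oplus (C.oplus x y) z = C.oplus x (C.oplus y z) :=
  C.ptr_oplus_eq hD (C.ptr_one_left _) z

theorem odot_oplus (hD : IsDesarguesian P L) (m x z : R) :
    C.odot m (C.oplus x z) = C.oplus (C.odot m x) (C.odot m z) := by
  by_cases hx : x = 0
  · rw [hx, odot_zero, zero_oplus, zero_oplus]
  by_cases hz : z = 0
  · rw [hz, odot_zero, oplus_zero, oplus_zero]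
  by_cases hm0 : m = 0
  · rw [hm0, zero_odot, zero_odot, zero_odot, oplus_zero]
  by_cases hm1 : m = 1
  · rw [hm1, one_odot, one_odot, one_odot]
  have hmz0 : C.odot m z ≠ 0 := C.odot_ne_zero hm0 hz
  have hmz : C.odot m z ≠ z := fun h => hm1 (C.odot_right_cancel hz (h.trans (C.one_odot z).symm))
  have hXl : ∀ k, C.slope 0 ∈ C.line 0 k := C.slope_mem_line 0
  have hxz : C.oplus x z ≠ x := fun h => hz (C.oplus_left_cancel (h.trans (C.oplus_zero x).symm))
  have hzx : z ≠ C.oplus x z := fun h => hx (C.oplus_right_cancel (h.symm.trans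
    (C.zero_oplus z).symm))
  have := C.ptr_eq_of_perspective hD (V := C.slope 0) (E := C.Y) (F := C.slope 1)
    (a := C.line 0 z) (b := C.line 0 0) (c := C.line 0 (C.odot m z))
    (CA := C.vert 0) (CA' := C.vert x) (AB := C.line 1 z) (AB' := C.line 1 (C.oplus x z))
    (x₁ := 0) (y₁ := z) (x₁' := x) (y₁' := z) (x₂ := z) (y₂ := 0) (x₂' := C.oplus x z) (y₂' := 0)
    (x₃ := 0) (y₃ := C.odot m z) (x₃' := x) (y₃' := C.odot m z) (d := m)
    (C.line_ne_line_of_const hz _ _) (C.line_ne_line_of_const (Ne.symm hmz0) _ _)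
    (C.line_ne_line_of_const hmz _ _) (hXl _) (hXl _) (hXl _)
    (C.pt_mem_line_iff.2 (C.ptr_zero_left _ _)) (C.pt_mem_line_iff.2 (C.ptr_zero_left _ _))
    (C.pt_mem_line_iff.2 (C.ptr_zero_left _ _)) (C.pt_mem_line_iff.2 (C.ptr_zero_left _ _))
    (C.pt_mem_line_iff.2 (C.ptr_zero_left _ _)) (C.pt_mem_line_iff.2 (C.ptr_zero_left _ _))
    (C.pt_ne_slope _ _ _) (C.pt_ne_slope _ _ _) (C.pt_ne_slope _ _ _) (C.pt_ne_slope _ _ _)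
    (C.pt_ne_slope _ _ _) (C.pt_ne_slope _ _ _) (C.pt_ne_of_fst (Ne.symm hx) _ _)
    (C.pt_ne_of_fst hzx _ _) (C.pt_ne_of_fst (Ne.symm hx) _ _)
    (C.pt_mem_vert_self _ _) (C.pt_mem_vert_self _ _) (C.Y_mem_vert _)
    (C.pt_mem_vert_self _ _) (C.pt_mem_vert_self _ _) (C.Y_mem_vert _)
    (C.pt_mem_line_iff.2 (C.ptr_zero_mid _ _)) (C.pt_mem_line_iff.2 (C.ptr_one_left _))
    (C.slope_mem_line _ _)
    (C.pt_mem_line_iff.2 rfl) (C.pt_mem_line_iff.2 (C.ptr_one_left _)) (C.slope_mem_line _ _)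
    C.Y_mem_lineInf (C.slope_mem 1) (C.slope_ne_Y 1).symm hxz (C.ptr_zero_mid _ _).symm
  rw [← C.ptr_eq_oplus_odot hD]
  exact this

theorem oplus_odot [Finite R] (hD : IsDesarguesian P L) (m a x : R) :
    C.odot (C.oplus m a) x = C.oplus (C.odot m x) (C.odot a x) := by
  by_cases hx : x = 0
  · rw [hx, odot_zero, odot_zero, odot_zero, oplus_zero]
  by_cases hx1 : x = 1
  · rw [hx1, odot_one, odot_one, odot_one]
  by_cases ha : a = 0
  · rw [ha, zero_odot, oplus_zero, oplus_zero]
  by_cases hm : m = 0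
  · rw [hm, zero_odot, zero_oplus, zero_oplus]
  set k := C.oplus (C.odot m x) (C.odot a x) with hk
  obtain ⟨y, hy⟩ : ∃ y, C.oplus m y = k :=
    Finite.surjective_of_injective (C.ptr_right_injective 1 m) k
  obtain ⟨z, hz⟩ : ∃ z, C.oplus a z = y :=
    Finite.surjective_of_injective (C.ptr_right_injective 1 a) y
  have hax : C.odot a x ≠ 0 := C.odot_ne_zero ha hx
  have hya : C.odot a x ≠ y := by
    rintro rfl
    exact hx1 (C.odot_left_cancel hm ((C.oplus_right_cancel (hk.symm.trans hy.symm)).trans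
      (C.odot_one m).symm))
  have hyz : y ≠ z := by
    rintro rfl
    exact ha (C.oplus_right_cancel (hz.trans (C.zero_oplus y).symm))
  obtain ⟨p, hp⟩ := C.exists_ptr_eq (Ne.symm hx1) z 0
  have := hD.mem_of_mem_axis (V := C.Y) (A := C.slope 0) (A' := C.slope a) (B := C.pt 1 y)
    (B' := C.pt 1 z) (C := C.pt x (C.odot a x)) (C' := C.pt x 0) (D := C.pt 0 k)
    (E := C.pt 0 (C.odot a x)) (F := C.pt 0 y) (a := C.lineInf) (b := C.vert 1) (c := C.vert x)
    (BC := C.line m k) (CA := C.line 0 (C.odot a x)) (AB := C.line 0 y)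
    (BC' := C.line p (C.ptr p x 0)) (CA' := C.line a (C.odot a x)) (AB' := C.line a y)
    (r := C.vert 0)
    (C.vert_ne_lineInf 1).symm (C.vert_ne_vert (Ne.symm hx1)) (C.vert_ne_lineInf x)
    C.Y_mem_lineInf (C.Y_mem_vert _) (C.Y_mem_vert _) (C.slope_mem _) (C.slope_mem _)
    (C.pt_mem_vert_self _ _) (C.pt_mem_vert_self _ _) (C.pt_mem_vert_self _ _)
    (C.pt_mem_vert_self _ _) (C.slope_ne_Y _) (C.slope_ne_Y _) (C.pt_ne_Y _ _) (C.pt_ne_Y _ _)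
    (C.pt_ne_Y _ _) (C.pt_ne_Y _ _) (fun h => ha (C.slope_injective h).symm)
    (C.pt_ne_of_snd hyz _ _) (C.pt_ne_of_snd hax _ _)
    (C.pt_mem_line_iff.2 (by rw [C.ptr_eq_oplus_odot hD, odot_one, hy]))
    (C.pt_mem_line_iff.2 (by rw [C.ptr_eq_oplus_odot hD]))
    (C.pt_mem_line_iff.2 (C.ptr_zero_left _ _)) (C.slope_mem_line _ _) (C.slope_mem_line _ _)
    (C.pt_mem_line_iff.2 (C.ptr_zero_left _ _))
    (C.pt_mem_line_iff.2 hp) (C.pt_mem_line_self _ _ _) (C.pt_mem_line_iff.2 rfl)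
    (C.slope_mem_line _ _) (C.slope_mem_line _ _)
    (C.pt_mem_line_iff.2 (by rw [C.ptr_eq_oplus_odot hD, odot_one, hz]))
    (C.pt_mem_line _ _) (C.pt_mem_line _ _) (C.pt_mem_vert_self _ _)
    (C.pt_mem_line _ _) (C.pt_mem_line _ _) (C.pt_mem_vert_self _ _)
    (C.pt_ne_of_snd hya _ _) (C.slope_not_mem_vert _) (C.slope_not_mem_vert _)
    (fun h => C.zero_ne_one (C.pt_mem_vert_iff.1 h).symm) (C.pt_mem_line _ _)
    (C.pt_mem_vert_self _ _)
  have hkp : C.odot p x = k := (C.pt_zero_mem_line_iff.1 this).symm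
  have hpm : p = C.oplus m a := by
    refine C.oplus_right_cancel (z := z) ?_
    rw [C.oplus_assoc hD, hz, hy, ← hkp, ← C.odot_one p, ← C.ptr_eq_oplus_odot hD, hp, odot_one]
    rfl
  rw [← hpm, hkp]

theorem odot_assoc [Finite R] (hD : IsDesarguesian P L) (a b c : R) :
    C.odot (C.odot a b) c = C.odot a (C.odot b c) := by
  by_cases ha0 : a = 0
  · rw [ha0, zero_odot, zero_odot, zero_odot]
  by_cases hb0 : b = 0
  · rw [hb0, zero_odot, odot_zero, zero_odot]
  by_cases hc0 : c = 0
  · rw [hc0, odot_zero, odot_zero, odot_zero]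
  by_cases ha1 : a = 1
  · rw [ha1, one_odot, one_odot]
  by_cases hb1 : b = 1
  · rw [hb1, one_odot, odot_one]
  by_cases hc1 : c = 1
  · rw [hc1, odot_one, odot_one]
  obtain ⟨a', ha'⟩ := C.exists_oplus_eq_zero a
  obtain ⟨e, he⟩ := C.exists_oplus_eq_zero (1 : R)
  have mem_a : ∀ x, C.pt x (C.odot a x) ∈ C.line a' 0 := fun x => by
    rw [pt_mem_line_iff, C.ptr_eq_oplus_odot hD, ← C.oplus_odot hD, ha', zero_odot]
  have mem_e : ∀ x, C.pt x x ∈ C.line e 0 := fun x => by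
    rw [pt_mem_line_iff, C.ptr_eq_oplus_odot hD]
    nth_rewrite 2 [← C.one_odot x]
    rw [← C.oplus_odot hD, he, zero_odot]
  have mem_0 : ∀ x, C.pt x 0 ∈ C.line 0 0 := C.pt_zero_mem
  have O_mem : ∀ m, C.pt 0 0 ∈ C.line m 0 := fun m => C.pt_mem_line m 0
  have O_vert : C.pt 0 0 ∈ C.vert 0 := C.pt_mem_vert_self 0 0
  have he0 : e ≠ 0 := by
    rintro rfl
    exact C.zero_ne_one ((C.zero_oplus 1).symm.trans he).symm
  have ha0' : a' ≠ 0 := by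
    rintro rfl
    exact ha0 ((C.zero_oplus a).symm.trans ha')
  have hea : e ≠ a' := by
    rintro rfl
    exact ha1 (C.oplus_left_cancel (ha'.trans he.symm))
  have ne_O : ∀ {x : R}, x ≠ 0 → ∀ y, C.pt x y ≠ C.pt 0 0 := fun h y => C.pt_ne_of_fst h _ _
  have ne_O' : ∀ {y : R}, y ≠ 0 → ∀ x, C.pt x y ≠ C.pt 0 0 := fun h x => C.pt_ne_of_snd h _ _
  have hbc0 := C.odot_ne_zero hb0 hc0
  have hab0 := C.odot_ne_zero ha0 hb0
  have ne_mul : ∀ {x : R}, x ≠ 0 → x ≠ C.odot x c := fun {x} hx h =>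
    hc1 (C.odot_left_cancel hx (h.symm.trans (C.odot_one x).symm))
  have hcbc : c ≠ C.odot b c := fun h =>
    hb1 (C.odot_right_cancel hc0 (h.symm.trans (C.one_odot c).symm))
  have line_mem : ∀ m, C.pt 1 0 ∈ C.line m m := fun m => C.pt_mem_line_iff.2 (C.ptr_one_mid m)
  have slope_ne : ∀ {m m' : R}, m ≠ m' → C.slope m ≠ C.slope m' := fun h e =>
    h (C.slope_injective e)
  have hor : ∀ x y, C.pt x y ∈ C.line 0 y := fun x y => C.pt_mem_line_iff.2 (C.ptr_zero_left _ _)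
  obtain ⟨s, hs⟩ := C.exists_ptr_eq (Ne.symm hb1) 0 b
  obtain ⟨r, hr⟩ := C.exists_ptr_eq (Ne.symm hb1) 0 (C.odot a b)
  have hsb : s ≠ b := by
    rintro rfl
    refine hb0 (C.eq_and_eq_of_ptr_eq (m := s) (m' := 0) (x := s) (y := s) (x' := 0) (y' := s)
      hb0 ?_ ?_).1
    · rw [← hs, ptr_one_mid, ptr_zero_mid]
    · rw [ptr_zero_left, ptr_zero_left]
  have hrab : r ≠ C.odot a b := by
    rintro rfl
    refine hb0 (C.eq_and_eq_of_ptr_eq (m := C.odot a b) (m' := 0) (x := b) (y := C.odot a b)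
      (x' := 0) (y' := C.odot a b) hab0 ?_ ?_).1
    · rw [← hr, ptr_one_mid, ptr_zero_mid]
    · rw [ptr_zero_left, ptr_zero_left]
  have h1 : C.ptr s c 0 = C.ptr s (C.odot b c) (C.odot b c) :=
    C.ptr_eq_of_perspective hD (V := C.pt 0 0) (a := C.vert 0) (b := C.line 0 0)
      (c := C.line e 0) (E := C.slope 0) (F := C.slope b) (CA := C.line 0 b)
      (CA' := C.line 0 (C.odot b c)) (AB := C.line b b) (AB' := C.line b (C.odot b c))
      (x₁ := 0) (y₁ := b) (x₁' := 0) (y₁' := C.odot b c)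
      (C.line_ne_vert _ _ _).symm (C.line_ne_line_of_slope he0.symm _ _) (C.line_ne_vert _ _ _)
      O_vert (O_mem _) (O_mem _) (C.pt_mem_vert_self _ _) (C.pt_mem_vert_self _ _)
      (mem_0 _) (mem_0 _) (mem_e _) (mem_e _) (ne_O' hb0 _) (ne_O' hbc0 _)
      (ne_O C.zero_ne_one.symm _) (ne_O hc0 _) (ne_O hb0 _) (ne_O hbc0 _)
      (C.pt_ne_of_snd (ne_mul hb0) _ _) (C.pt_ne_of_fst (Ne.symm hc1) _ _)
      (C.pt_ne_of_fst (ne_mul hb0) _ _)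
      (hor _ _) (hor _ _) (C.slope_mem_line _ _) (hor _ _) (hor _ _) (C.slope_mem_line _ _)
      (C.pt_mem_line _ _) (line_mem b) (C.slope_mem_line _ _)
      (C.pt_mem_line _ _) (C.pt_mem_line_iff.2 rfl) (C.slope_mem_line _ _)
      (C.slope_mem _) (C.slope_mem _) (slope_ne (Ne.symm hb0)) hcbc hs
  have h2 : C.ptr r c 0 = C.ptr r (C.odot b c) (C.odot a (C.odot b c)) :=
    C.ptr_eq_of_perspective hD (V := C.pt 0 0) (a := C.line e 0) (b := C.line 0 0)
      (c := C.line a' 0) (E := C.Y) (F := C.slope s) (CA := C.vert b)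
      (CA' := C.vert (C.odot b c)) (AB := C.line s (C.ptr s b b))
      (AB' := C.line s (C.ptr s (C.odot b c) (C.odot b c)))
      (x₁ := b) (y₁ := b) (x₁' := C.odot b c) (y₁' := C.odot b c)
      (C.line_ne_line_of_slope he0 _ _) (C.line_ne_line_of_slope ha0'.symm _ _)
      (C.line_ne_line_of_slope hea.symm _ _) (O_mem _) (O_mem _) (O_mem _) (mem_e _) (mem_e _)
      (mem_0 _) (mem_0 _) (mem_a _) (mem_a _) (ne_O hb0 _) (ne_O hbc0 _)
      (ne_O C.zero_ne_one.symm _) (ne_O hc0 _) (ne_O hb0 _) (ne_O hbc0 _)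
      (C.pt_ne_of_fst (ne_mul hb0) _ _) (C.pt_ne_of_fst (Ne.symm hc1) _ _)
      (C.pt_ne_of_fst (ne_mul hb0) _ _)
      (C.pt_mem_vert_self _ _) (C.pt_mem_vert_self _ _) (C.Y_mem_vert _)
      (C.pt_mem_vert_self _ _) (C.pt_mem_vert_self _ _) (C.Y_mem_vert _)
      (C.pt_mem_line_self _ _ _) (C.pt_mem_line_iff.2 hs) (C.slope_mem_line _ _)
      (C.pt_mem_line_self _ _ _) (C.pt_mem_line_iff.2 h1) (C.slope_mem_line _ _)
      C.Y_mem_lineInf (C.slope_mem _) (C.slope_ne_Y _).symm hcbc hr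
  have h3 : C.ptr 0 (C.odot b c) (C.odot a (C.odot b c)) = C.ptr 0 0 (C.odot (C.odot a b) c) :=
    C.ptr_eq_of_perspective hD (V := C.pt 0 0) (a := C.line 0 0) (b := C.line a' 0)
      (c := C.vert 0) (E := C.slope (C.odot a b)) (F := C.slope r)
      (CA := C.line (C.odot a b) (C.odot a b))
      (CA' := C.line (C.odot a b) (C.odot (C.odot a b) c))
      (AB := C.line r (C.ptr r b (C.odot a b)))
      (AB' := C.line r (C.ptr r (C.odot b c) (C.odot a (C.odot b c))))
      (x₁ := 1) (y₁ := 0) (x₁' := c) (y₁' := 0) (x₂ := b) (y₂ := C.odot a b)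
      (x₃ := 0) (y₃ := C.odot a b)
      (C.line_ne_line_of_slope ha0'.symm _ _) (C.line_ne_vert _ _ _) (C.line_ne_vert _ _ _).symm
      (O_mem _) (O_mem _) O_vert (mem_0 _) (mem_0 _) (mem_a _) (mem_a _)
      (C.pt_mem_vert_self _ _) (C.pt_mem_vert_self _ _)
      (ne_O C.zero_ne_one.symm _) (ne_O hc0 _) (ne_O hb0 _) (ne_O hbc0 _) (ne_O' hab0 _)
      (ne_O' (C.odot_ne_zero hab0 hc0) _) (C.pt_ne_of_fst (Ne.symm hc1) _ _)
      (C.pt_ne_of_fst (ne_mul hb0) _ _) (C.pt_ne_of_snd (ne_mul hab0) _ _)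
      (C.pt_mem_line _ _) (line_mem _) (C.slope_mem_line _ _)
      (C.pt_mem_line _ _) (C.pt_mem_line_iff.2 rfl) (C.slope_mem_line _ _)
      (C.pt_mem_line_iff.2 hr) (C.pt_mem_line_self _ _ _) (C.slope_mem_line _ _)
      (C.pt_mem_line_iff.2 h2) (C.pt_mem_line_self _ _ _) (C.slope_mem_line _ _)
      (C.slope_mem _) (C.slope_mem _) (slope_ne hrab.symm) hbc0
      (by rw [ptr_zero_left, ptr_zero_left])
  rw [ptr_zero_left, ptr_zero_left] at h3
  exact h3.symm

theorem oplus_comm [Finite R] (hD : IsDesarguesian P L) (x y : R) :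
    C.oplus x y = C.oplus y x := by
  have h1 : C.odot (C.oplus 1 1) (C.oplus x y) =
      C.oplus x (C.oplus (C.oplus x y) y) := by
    rw [C.odot_oplus hD, C.oplus_odot hD, C.oplus_odot hD, one_odot, one_odot]
    simp only [C.oplus_assoc hD]
  have h2 : C.odot (C.oplus 1 1) (C.oplus x y) =
      C.oplus x (C.oplus (C.oplus y x) y) := by
    rw [C.oplus_odot hD, one_odot]
    simp only [C.oplus_assoc hD]
  exact C.oplus_right_cancel (C.oplus_left_cancel (h1.symm.trans h2))

/-- A finite Desarguesian plane is coordinatised by a field. -/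
theorem exists_field [Finite R] (hD : IsDesarguesian P L) :
    ∃ _ : Field R, (∀ x y : R, x + y = C.oplus x y) ∧ ∀ x y : R, x * y = C.odot x y := by
  choose neg hneg using C.exists_oplus_eq_zero
  let ring : Ring R :=
    { add := C.oplus
      mul := C.odot
      zero := 0
      one := 1
      neg := neg
      add_assoc := C.oplus_assoc hD
      zero_add := C.zero_oplus
      add_zero := C.oplus_zero
      add_comm := C.oplus_comm hD
      neg_add_cancel := hneg
      mul_assoc := C.odot_assoc hD
      one_mul := C.one_odot
      mul_one := C.odot_one
      zero_mul := C.zero_odot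
      mul_zero := C.odot_zero
      left_distrib := C.odot_oplus hD
      right_distrib := C.oplus_odot hD
      nsmul := @nsmulRec R ⟨0⟩ ⟨C.oplus⟩
      zsmul := @zsmulRec R ⟨0⟩ ⟨C.oplus⟩ ⟨neg⟩ (@nsmulRec R ⟨0⟩ ⟨C.oplus⟩) }
  have : @Nontrivial R := ⟨0, 1, C.zero_ne_one⟩
  have : NoZeroDivisors R :=
    ⟨fun {a b} h => by
      by_contra! hc
      exact C.odot_ne_zero hc.1 hc.2 h⟩
  have : IsDomain R := NoZeroDivisors.to_isDomain R
  exact ⟨(Finite.isDomain_to_isField R).toField, fun _ _ => rfl, fun _ _ => rfl⟩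

end Coordinatisation

section Existence

variable {P : Type u} {L : Type v} {R : Type w} [Membership P L] [ProjectivePlane P L]
  [Zero R] [One R]

/-- A quadrangle together with a labelling of the points of `OY` other than `Y` determines a
coordinatisation. -/
theorem exists_coordinatisation {O X Y I : P} (hOXY : ¬ AreCollinear L O X Y)
    (hOXI : ¬ AreCollinear L O X I) (hOYI : ¬ AreCollinear L O Y I)
    (hXYI : ¬ AreCollinear L X Y I) {l : L} (hOl : O ∈ l) (hYl : Y ∈ l) {f : R → P}
    (hf : Set.BijOn f Set.univ {p | p ∈ l ∧ p ≠ Y}) (hf0 : f 0 = O)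
    (hf1 : AreCollinear L X I (f 1)) :
    ∃ C : Coordinatisation P L R,
      C.O = O ∧ C.X = X ∧ C.Y = Y ∧ C.I = I ∧ ∀ a, C.pt 0 a = f a := by
  choose join mem_join_left mem_join_right using exists_line_through (P := P) (L := L)
  choose meet meet_mem_left meet_mem_right using exists_mem_inter (P := P) (L := L)
  have hfl : ∀ a, f a ∈ l := fun a => (hf.mapsTo (Set.mem_univ a)).1
  have hfY : ∀ a, f a ≠ Y := fun a => (hf.mapsTo (Set.mem_univ a)).2
  have hXl : X ∉ l := fun h => hOXY ⟨l, hOl, h, hYl⟩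
  have hIl : I ∉ l := fun h => hOYI ⟨l, hOl, hYl, h⟩
  have hOY : O ≠ Y := by
    rintro rfl
    exact hOXY ⟨join O X, mem_join_left _ _, mem_join_right _ _, mem_join_left _ _⟩
  have hOX : O ≠ X := by
    rintro rfl
    exact hXl hOl
  have hXY : X ≠ Y := by
    rintro rfl
    exact hXl hYl
  have hIX : I ≠ X := by
    rintro rfl
    exact hOXI ⟨join O I, mem_join_left _ _, mem_join_right _ _, mem_join_right _ _⟩
  have hIY : I ≠ Y := by
    rintro rfl
    exact hIl hYl
  have hYh : Y ∉ join O X := fun h => hOXY ⟨_, mem_join_left _ _, mem_join_right _ _, h⟩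
  have hOi : O ∉ join X Y := fun h => hOXY ⟨_, h, mem_join_left _ _, mem_join_right _ _⟩
  have hIh : I ∉ join O X := fun h => hOXI ⟨_, mem_join_left _ _, mem_join_right _ _, h⟩
  have hIi : I ∉ join X Y := fun h => hXYI ⟨_, mem_join_left _ _, mem_join_right _ _, h⟩
  have hXf : ∀ a, f a ≠ X := fun a h => hXl (h ▸ hfl a)
  have ne_line : ∀ {p : P} {m m' : L}, p ∈ m → p ∉ m' → m ≠ m' := by
    rintro p m m' h h' rfl
    exact h' h
  have hfi : ∀ a, f a ∉ join X Y := fun a h => hfY a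
    (point_eq_of_mem (ne_line hOl hOi) (hfl a) hYl h (mem_join_right X Y))
  have hfinj : ∀ {a b}, f a = f b → a = b := fun h =>
    hf.injOn (Set.mem_univ _) (Set.mem_univ _) h
  have hfO : ∀ {a}, f a ∈ join O X → f a = O := fun {a} h =>
    point_eq_of_mem (ne_line hYl hYh) (hfl a) hOl h (mem_join_left O X)
  have h01 : f 1 ≠ O := fun h => by
    obtain ⟨m, h1, h2, h3⟩ := hf1
    exact hOXI ⟨m, h ▸ h3, h1, h2⟩
  -- the points `(1, 0)`, `(1)`, `(a, 0)`, `(a)`, `(a, b)`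
  obtain ⟨e, he⟩ : ∃ e, e = meet (join Y I) (join O X) := ⟨_, rfl⟩
  have heYI : e ∈ join Y I := he ▸ meet_mem_left _ _
  have heh : e ∈ join O X := he ▸ meet_mem_right _ _
  have hel : e ∉ l := fun h => by
    have : e = O := point_eq_of_mem (ne_line hYl hYh) h hOl heh (mem_join_left O X)
    exact hOYI ⟨join Y I, this ▸ heYI, mem_join_left _ _, mem_join_right _ _⟩
  have heX : e ≠ X := fun h =>
    hXYI ⟨join Y I, h ▸ heYI, mem_join_left _ _, mem_join_right _ _⟩
  have hei : e ∉ join X Y := fun h => heX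
    (point_eq_of_mem (ne_line (mem_join_right X Y) hYh) h (mem_join_left X Y) heh
      (mem_join_right O X))
  have hfe : ∀ a, f a ≠ e := fun a h => hel (h ▸ hfl a)
  obtain ⟨sl, hsl⟩ : ∃ sl : R → P, sl = fun a => meet (join (f a) e) (join X Y) := ⟨_, rfl⟩
  have hsl1 : ∀ a, sl a ∈ join (f a) e := fun a => hsl ▸ meet_mem_left _ _
  have hsl2 : ∀ a, sl a ∈ join X Y := fun a => hsl ▸ meet_mem_right _ _
  have hsl0 : sl 0 = X := by
    have h := hsl1 0
    rw [hf0] at h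
    have heO : e ≠ O := fun h => hfe 0 (hf0.trans h.symm)
    have h' : sl 0 ∈ join O X := line_eq_of_mem heO (mem_join_right O e) (mem_join_left O e)
      heh (mem_join_left O X) ▸ h
    exact point_eq_of_mem (ne_line (mem_join_left O X) hOi) h' (mem_join_right O X) (hsl2 0)
      (mem_join_left X Y)
  have hslh : sl 1 ∉ join O X := fun h => by
    have h1 : sl 1 = X := point_eq_of_mem (ne_line (mem_join_left O X) hOi) h
      (mem_join_right O X) (hsl2 1) (mem_join_left X Y)
    have h2 : join (f 1) e = join O X := line_eq_of_mem heX (mem_join_right _ _)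
      (h1 ▸ hsl1 1) heh (mem_join_right O X)
    exact h01 (hfO (h2 ▸ mem_join_left _ _))
  obtain ⟨ax, hax⟩ : ∃ ax : R → P, ax = fun a => meet (join (f a) (sl 1)) (join O X) := ⟨_, rfl⟩
  have hax1 : ∀ a, ax a ∈ join (f a) (sl 1) := fun a => hax ▸ meet_mem_left _ _
  have hax2 : ∀ a, ax a ∈ join O X := fun a => hax ▸ meet_mem_right _ _
  have hax0 : ax 0 = O := by
    have h := hax1 0
    rw [hf0] at h
    exact point_eq_of_mem (ne_line (mem_join_right O (sl 1)) hslh) h (mem_join_left _ _) (hax2 0)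
      (mem_join_left O X)
  have hslf : ∀ a b, sl a ≠ f b := fun a b h => hfi b (h ▸ hsl2 a)
  have hax1e : ax 1 = e := by
    have h : e ∈ join (f 1) (sl 1) := line_eq_of_mem (hslf 1 1) (hsl1 1)
      (mem_join_left _ _) (mem_join_right _ _) (mem_join_left _ _) ▸ mem_join_right (f 1) e
    exact point_eq_of_mem (ne_line (mem_join_right _ _) hslh) (hax1 1) h (hax2 1) heh
  have haxY : ∀ a, ax a ≠ Y := fun a h => hYh (h ▸ hax2 a)
  have haxX : ∀ a, ax a ≠ X := fun a h => by
    have h1 : sl 1 ≠ X := fun h => hslh (h ▸ mem_join_right O X)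
    exact hfi a (line_eq_of_mem h1 (mem_join_right _ _) (h ▸ hax1 a) (hsl2 1)
      (mem_join_left X Y) ▸ mem_join_left (f a) (sl 1))
  obtain ⟨pt, hpt⟩ : ∃ pt : R → R → P,
    pt = fun a b => meet (join (ax a) Y) (join (f b) X) := ⟨_, rfl⟩
  have hpt1 : ∀ a b, pt a b ∈ join (ax a) Y := fun a b => hpt ▸ meet_mem_left _ _
  have hpt2 : ∀ a b, pt a b ∈ join (f b) X := fun a b => hpt ▸ meet_mem_right _ _
  have hjl : join O Y = l := line_eq_of_mem hOY (mem_join_left _ _) (mem_join_right _ _) hOl hYl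
  have hpt0 : ∀ b, pt 0 b = f b := fun b => by
    have h := hpt1 0 b
    rw [hax0, hjl] at h
    exact point_eq_of_mem (ne_line (mem_join_right (f b) X) hXl).symm h (hfl b) (hpt2 0 b)
      (mem_join_left _ _)
  have hpta : ∀ a, pt a 0 = ax a := fun a => by
    have h := hpt2 a 0
    rw [hf0] at h
    exact point_eq_of_mem (ne_line (mem_join_right (ax a) Y) hYh) (hpt1 a 0) (mem_join_left _ _)
      h (hax2 a)
  have hpt11 : pt 1 1 = I := by
    have h1 := hpt1 1 1
    have h2 := hpt2 1 1
    have heY : e ≠ Y := fun h => haxY 1 (hax1e.trans h)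
    rw [hax1e, line_eq_of_mem heY (mem_join_left _ _) (mem_join_right _ _) heYI
      (mem_join_left Y I)] at h1
    obtain ⟨m, k1, k2, k3⟩ := hf1
    rw [line_eq_of_mem (hXf 1) (mem_join_left _ _) (mem_join_right _ _) k3 k1] at h2
    refine point_eq_of_mem (fun h => ?_) h1 (mem_join_right _ _) h2 k2
    exact hXYI ⟨m, k1, h ▸ mem_join_left Y I, k2⟩
  refine ⟨{
    O := O, X := X, Y := Y, I := I
    not_collinear_OXY := hOXY
    not_collinear_OXI := hOXI
    not_collinear_OYI := hOYI
    not_collinear_XYI := hXYI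
    pt := pt
    slope := sl
    lineInf := join X Y
    vert := fun a => join (ax a) Y
    line := fun m k => join (sl m) (f k)
    pt_zero_zero := (hpt0 0).trans hf0
    slope_zero := hsl0
    pt_one_one := hpt11
    X_mem_lineInf := mem_join_left _ _
    Y_mem_lineInf := mem_join_right _ _
    O_mem_vert_zero := by rw [hax0]; exact mem_join_left _ _
    Y_mem_vert_zero := mem_join_right _ _
    O_mem_line_zero_zero := by rw [hf0]; exact mem_join_right _ _
    X_mem_line_zero_zero := by rw [hsl0]; exact mem_join_left _ _
    collinear_zero_one := by rw [hpt0]; exact hf1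
    collinear_one_zero := by
      rw [hpta, hax1e]
      exact ⟨_, mem_join_left _ _, mem_join_right _ _, heYI⟩
    collinear_slope_one := by
      rw [hpta, hax1e, hpt0]
      exact ⟨_, mem_join_right _ _, mem_join_left _ _, hsl1 1⟩
    bijOn_pt_zero := by
      rw [hax0, hjl, show pt 0 = f from funext hpt0]
      exact hf
    pt_zero_mem := fun a => by
      rw [hpta, hsl0, hf0, line_eq_of_mem hOX (mem_join_right _ _) (mem_join_left _ _)
        (mem_join_left O X) (mem_join_right O X)]
      exact hax2 a
    collinear_pt_zero := fun a => by
      rw [hpt0, hpta]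
      exact ⟨_, mem_join_left _ _, mem_join_right _ _, hax1 a⟩
    slope_mem := hsl2
    collinear_slope := fun a => by
      rw [hpt0, hpta, hax1e]
      exact ⟨_, mem_join_left _ _, mem_join_right _ _, hsl1 a⟩
    collinear_pt_Y := fun a b => by
      rw [hpta]
      exact ⟨_, mem_join_left _ _, mem_join_right _ _, hpt1 a b⟩
    collinear_pt_X := fun a b => by
      rw [hpt0]
      exact ⟨_, mem_join_left _ _, mem_join_right _ _, hpt2 a b⟩
    pt_mem_vert := fun a => by
      rw [hpta]
      exact mem_join_left _ _
    Y_mem_vert := fun a => mem_join_right _ _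
    slope_mem_line := fun m k => mem_join_left _ _
    pt_mem_line := fun m k => by
      rw [hpt0]
      exact mem_join_right _ _ }, rfl, rfl, rfl, rfl, hpt0⟩

variable (P L) in
theorem exists_quadrangle [Finite P] [Finite L] :
    ∃ O X Y I : P, ¬ AreCollinear L O X Y ∧ ¬ AreCollinear L O X I ∧ ¬ AreCollinear L O Y I ∧
      ¬ AreCollinear L X Y I := by
  have third : ∀ (l : L) (p r : P), ∃ s : P, s ∈ l ∧ s ≠ p ∧ s ≠ r := by
    intro l p r
    have h1 : 2 < pointCount P l := ProjectivePlane.two_lt_pointCount P l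
    have h2 : ({p, r} : Set P).ncard < {s : P | s ∈ l}.ncard :=
      (Set.ncard_insert_le p {r}).trans_lt (by rw [Set.ncard_singleton]; exact h1)
    obtain ⟨s, hs, hs'⟩ := Set.exists_mem_notMem_of_ncard_lt_ncard h2
    simp only [Set.mem_insert_iff, Set.mem_singleton_iff, not_or] at hs'
    exact ⟨s, hs, hs'⟩
  obtain ⟨p₁, p₂, p₃, l₁, l₂, l₃, h12, -, -, h22, h23, -, h32, h33⟩ :=
    ProjectivePlane.exists_config (P := P) (L := L)
  have hne : p₂ ≠ p₃ := by
    rintro rfl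
    exact h33 h23
  obtain ⟨u, hu, hu2, hu3⟩ := third l₂ p₂ p₃
  obtain ⟨m, hm1, hmu⟩ := exists_line_through (L := L) p₁ u
  obtain ⟨I, hI, hI1, hIu⟩ := third m p₁ u
  have hml : m ≠ l₂ := by
    rintro rfl
    exact h12 hm1
  have hp : ∀ p, p ∈ l₂ → p ≠ u → ¬ AreCollinear L p₁ p I := by
    rintro p hp hpu ⟨k, k1, k2, k3⟩
    have hkm : k = m := line_eq_of_mem hI1.symm k1 k3 hm1 hI
    exact hpu (point_eq_of_mem hml (hkm ▸ k2) hmu hp hu)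
  refine ⟨p₁, p₂, p₃, I, ?_, hp p₂ h22 hu2.symm, hp p₃ h32 hu3.symm, ?_⟩
  · rintro ⟨k, k1, k2, k3⟩
    exact h12 (line_eq_of_mem hne k2 k3 h22 h32 ▸ k1)
  · rintro ⟨k, k1, k2, k3⟩
    have hk : k = l₂ := line_eq_of_mem hne k1 k2 h22 h32
    exact hIu (point_eq_of_mem hml hI hmu (hk ▸ k3) hu)

theorem natCard_points_ne [Finite P] [Finite L] {l : L} {p : P} (hp : p ∈ l) :
    Nat.card {s : P | s ∈ l ∧ s ≠ p} = ProjectivePlane.order P L := by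
  have h1 : pointCount P l = ProjectivePlane.order P L + 1 := ProjectivePlane.pointCount_eq P l
  have h2 : {s : P | s ∈ l ∧ s ≠ p} = {s : P | s ∈ l} \ {p} := rfl
  rw [Nat.card_coe_set_eq, h2, Set.ncard_sdiff_singleton_of_mem (show p ∈ {s : P | s ∈ l} from hp)]
  change pointCount P l - 1 = _
  rw [h1, Nat.add_sub_cancel]

end Existence

theorem exists_bijOn_of_natCard_eq {α : Type u} {β : Type v} [Finite α] {s : Set β}
    (h : Nat.card α = Nat.card s) (hs : s.Finite) {a a' : α} (ha : a ≠ a') {b b' : β}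
    (hb : b ∈ s) (hb' : b' ∈ s) (hbb : b ≠ b') :
    ∃ f : α → β, Set.BijOn f Set.univ s ∧ f a = b ∧ f a' = b' := by
  classical
  have := hs.to_subtype
  let e : α ≃ s := (Finite.equivFin α).trans ((finCongr h).trans (Finite.equivFin s).symm)
  let e₁ := e.trans (Equiv.swap (e a) ⟨b, hb⟩)
  have h1 : e₁ a = ⟨b, hb⟩ := Equiv.swap_apply_left _ _
  let e₂ := e₁.trans (Equiv.swap (e₁ a') ⟨b', hb'⟩)
  have h2 : e₂ a' = ⟨b', hb'⟩ := Equiv.swap_apply_left _ _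
  have h3 : e₂ a = ⟨b, hb⟩ := by
    have h4 : e₁ a ≠ e₁ a' := fun h => ha (e₁.injective h)
    have h5 : e₁ a ≠ ⟨b', hb'⟩ := fun h => hbb (congrArg Subtype.val (h1.symm.trans h))
    exact (Equiv.swap_apply_of_ne_of_ne h4 h5).trans h1
  refine ⟨fun x => (e₂ x : β), ⟨fun x _ => (e₂ x).2,
    fun x _ y _ hxy => e₂.injective (Subtype.ext hxy),
    fun y hy => ⟨e₂.symm ⟨y, hy⟩, Set.mem_univ _, ?_⟩⟩, congrArg Subtype.val h3,
    congrArg Subtype.val h2⟩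
  exact congrArg Subtype.val (e₂.apply_symm_apply ⟨y, hy⟩)

namespace SubConfiguration

theorem areCollinear_coe {P : Type u} {L : Type v} [Membership P L]
    {S : SubConfiguration P L} {p q r : S.points} (h : AreCollinear S.lines p q r) :
    AreCollinear L (p : P) (q : P) (r : P) := by
  obtain ⟨l, h1, h2, h3⟩ := h
  exact ⟨l, h1, h2, h3⟩

variable {P : Type u} {L : Type v} [Membership P L] [ProjectivePlane P L]
  {S : SubConfiguration P L} [ProjectivePlane S.points S.lines]

theorem areCollinear_coe_iff {p q r : S.points} :
    AreCollinear L (p : P) (q : P) (r : P) ↔ AreCollinear S.lines p q r := by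
  refine ⟨fun h => ?_, areCollinear_coe⟩
  by_cases hpq : p = q
  · subst hpq
    obtain ⟨l, h1, h2⟩ := exists_line_through (L := S.lines) p r
    exact ⟨l, h1, h1, h2⟩
  · obtain ⟨l, h1, h2⟩ := exists_line_through (L := S.lines) p q
    exact ⟨l, h1, h2, h.mem_of_ne (fun e => hpq (Subtype.ext e)) h1 h2⟩

variable {R : Type w} [Zero R] [One R] {K : Set R} [Zero K] [One K]

/-- A coordinatisation of a subplane that is compatible with one of the ambient plane has the
restriction of the ambient ternary ring as its ternary ring. -/
theorem coe_ptr_eq {C : Coordinatisation P L R} {C' : Coordinatisation S.points S.lines K}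
    (h1 : ((1 : K) : R) = 1)
    (hO : C.O = C'.O) (hX : C.X = C'.X) (hY : C.Y = C'.Y) (hI : C.I = C'.I)
    (hpt : ∀ a : K, C.pt 0 a = C'.pt 0 a) (m x y : K) :
    (C'.ptr m x y : R) = C.ptr m x y := by
  have ne : ∀ {p q : S.points}, p ≠ q → (p : P) ≠ q := fun h e => h (Subtype.ext e)
  have hXY : C.X ≠ C.Y := fun e => C.slope_ne_Y 0 (C.slope_zero.trans e)
  have hOX : C.O ≠ C.X := C.pt_zero_zero ▸ C.slope_zero ▸ C.pt_ne_slope 0 0 0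
  have hXI : C.X ≠ C.I := C.pt_one_one ▸ C.slope_zero ▸ (C.pt_ne_slope 1 1 0).symm
  have hYI : C.Y ≠ C.I := C.pt_one_one ▸ (C.pt_ne_Y 1 1).symm
  have hinf : C.lineInf = C'.lineInf := line_eq_of_mem hXY C.X_mem_lineInf C.Y_mem_lineInf
    (hX ▸ C'.X_mem_lineInf) (hY ▸ C'.Y_mem_lineInf)
  have hh : C.line 0 0 = C'.line 0 0 := line_eq_of_mem hOX C.O_mem_line_zero_zero
    C.X_mem_line_zero_zero (hO ▸ C'.O_mem_line_zero_zero) (hX ▸ C'.X_mem_line_zero_zero)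
  have he : C.pt 1 0 = C'.pt 1 0 := by
    obtain ⟨l, k1, k2, k3⟩ := C.collinear_one_zero
    have k4 : AreCollinear L C.Y C.I (C'.pt 1 0) := by
      rw [hY, hI]
      exact areCollinear_coe C'.collinear_one_zero
    have hl : l ≠ C.line 0 0 := fun e => C.Y_not_mem_line 0 0 (e ▸ k1)
    refine point_eq_of_mem hl k3 (k4.mem_of_ne hYI k1 k2) (C.pt_zero_mem 1) ?_
    rw [hh]
    exact C'.pt_zero_mem 1
  have hslope : ∀ a : K, C.slope a = C'.slope a := fun a => by
    obtain ⟨l, k1, k2, k3⟩ := C.collinear_slope (a : R)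
    have k4 : AreCollinear L (C.pt 0 (a : R)) (C.pt 1 0) (C'.slope a) := by
      rw [hpt, he]
      exact areCollinear_coe (C'.collinear_slope a)
    refine point_eq_of_mem (fun e => C.pt_not_mem_lineInf _ _ (e ▸ k1)) k3
      (k4.mem_of_ne (C.pt_ne_of_fst C.zero_ne_one _ _) k1 k2) (C.slope_mem _) ?_
    rw [hinf]
    exact C'.slope_mem a
  have hax : ∀ a : K, C.pt a 0 = C'.pt a 0 := fun a => by
    obtain ⟨l, k1, k2, k3⟩ := C.collinear_pt_zero (a : R)
    have k4 : AreCollinear L (C.pt 0 (a : R)) (C.slope 1) (C'.pt a 0) := by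
      rw [hpt, ← h1, hslope]
      exact areCollinear_coe (C'.collinear_pt_zero a)
    refine point_eq_of_mem (fun e => ?_) k3
      (k4.mem_of_ne (C.pt_ne_slope _ _ _) k1 k2) (C.pt_zero_mem _) ?_
    · exact C.zero_ne_one (C.slope_mem_line_iff.1 (e ▸ k2)).symm
    · rw [hh]
      exact C'.pt_zero_mem a
  have hpt' : ∀ a b : K, C.pt a b = C'.pt a b := fun a b => by
    obtain ⟨l, k1, k2, k3⟩ := C.collinear_pt_Y (a : R) (b : R)
    obtain ⟨l', j1, j2, j3⟩ := C.collinear_pt_X (a : R) (b : R)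
    have k4 : AreCollinear L (C.pt (a : R) 0) C.Y (C'.pt a b) := by
      rw [hax, hY]
      exact areCollinear_coe (C'.collinear_pt_Y a b)
    have j4 : AreCollinear L (C.pt 0 (b : R)) C.X (C'.pt a b) := by
      rw [hpt, hX]
      exact areCollinear_coe (C'.collinear_pt_X a b)
    have hbX : C.pt 0 (b : R) ≠ C.X := C.slope_zero ▸ C.pt_ne_slope 0 b 0
    refine point_eq_of_mem (fun e => ?_) k3 (k4.mem_of_ne (C.pt_ne_Y _ _) k1 k2) j3
      (j4.mem_of_ne hbX j1 j2)
    have hl : l = C.lineInf := line_eq_of_mem hXY (e ▸ j2) k2 C.X_mem_lineInf C.Y_mem_lineInf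
    exact C.pt_not_mem_lineInf _ _ (hl ▸ k1)
  have hline : ∀ m k : K, C.line m k = C'.line m k := fun m k =>
    line_eq_of_mem (C.pt_ne_slope 0 k m) (C.pt_mem_line _ _) (C.slope_mem_line _ _)
      (hpt k ▸ C'.pt_mem_line m k) (hslope m ▸ C'.slope_mem_line m k)
  symm
  rw [Coordinatisation.ptr_eq_iff, hpt', hline]
  exact C'.pt_mem_line_self m x y

end SubConfiguration

end Configuration

open Configuration in
theorem mainTheorem12 {P : Type*} {L : Type*} [Membership P L] [Finite P] [Finite L]
    [Configuration.ProjectivePlane P L] (n : ℕ)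
    (hn : Configuration.ProjectivePlane.order P L = n)
    (S : Configuration.SubConfiguration P L)
    [Configuration.ProjectivePlane S.points S.lines] (q : ℕ)
    (hq : Configuration.ProjectivePlane.order S.points S.lines = q)
    (hS : Configuration.IsDesarguesian S.points S.lines)
    (R : Type*) [Zero R] [One R] (h01 : (0 : R) ≠ 1) (hR : Nat.card R = n) :
    ∃ (C : Configuration.Coordinatisation P L R) (K : Set R) (_ : Field K),
      Nat.card K = q ∧
        (∀ x y : K, ((x + y : K) : R) = C.oplus x y) ∧
        (∀ x y : K, ((x * y : K) : R) = C.odot x y) := by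
  have hRfin : Finite R := Nat.finite_of_card_ne_zero <| by
    have := ProjectivePlane.one_lt_order P L
    omega
  obtain ⟨O, X, Y, I, hOXY, hOXI, hOYI, hXYI⟩ := exists_quadrangle S.points S.lines
  obtain ⟨l, hOl, hYl⟩ := exists_line_through (L := S.lines) O Y
  obtain ⟨k, hXk, hIk⟩ := exists_line_through (L := S.lines) X I
  obtain ⟨E, hEl, hEk⟩ := exists_mem_inter (P := S.points) l k
  have hEO : O ≠ E := by
    rintro rfl
    exact hOXI ⟨k, hEk, hXk, hIk⟩
  have hEY : E ≠ Y := by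
    rintro rfl
    exact hXYI ⟨k, hXk, hEk, hIk⟩
  have hOY : O ≠ Y := by
    rintro rfl
    obtain ⟨m, h1, h2⟩ := exists_line_through (L := S.lines) O X
    exact hOXY ⟨m, h1, h2, h1⟩
  have coe_ne : ∀ {p r : S.points}, p ≠ r → (p : P) ≠ r := fun h e => h (Subtype.ext e)
  obtain ⟨f, hf, hf0, hf1⟩ := exists_bijOn_of_natCard_eq (s := {p : P | p ∈ (l : L) ∧ p ≠ Y})
    (hR.trans (hn.symm.trans (natCard_points_ne (show (Y : P) ∈ (l : L) from hYl)).symm))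
    (Set.toFinite _) h01 (b := (O : P)) (b' := (E : P)) ⟨hOl, coe_ne hOY⟩ ⟨hEl, coe_ne hEY⟩
    (coe_ne hEO)
  obtain ⟨C, hCO, hCX, hCY, hCI, hCf⟩ := exists_coordinatisation
    (mt SubConfiguration.areCollinear_coe_iff.1 hOXY)
    (mt SubConfiguration.areCollinear_coe_iff.1 hOXI)
    (mt SubConfiguration.areCollinear_coe_iff.1 hOYI)
    (mt SubConfiguration.areCollinear_coe_iff.1 hXYI) (l := (l : L)) hOl hYl hf hf0
    ⟨(k : L), hXk, hIk, hf1.symm ▸ hEk⟩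
  let K : Set R := {a | f a ∈ S.points}
  let : Zero K := ⟨⟨0, show f 0 ∈ S.points from hf0.symm ▸ O.2⟩⟩
  let : One K := ⟨⟨1, show f 1 ∈ S.points from hf1.symm ▸ E.2⟩⟩
  let g : K → S.points := fun a => ⟨f a, a.2⟩
  have hg : Set.BijOn g Set.univ {p | p ∈ l ∧ p ≠ Y} := by
    refine ⟨fun a _ => ?_, fun a _ b _ h => ?_, fun p hp => ?_⟩
    · have := hf.mapsTo (Set.mem_univ (a : R))
      exact ⟨this.1, fun h => this.2 (congrArg Subtype.val h)⟩
    · exact Subtype.ext (hf.injOn (Set.mem_univ _) (Set.mem_univ _) (congrArg Subtype.val h))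
    · obtain ⟨a, -, ha⟩ := hf.surjOn ⟨hp.1, coe_ne hp.2⟩
      exact ⟨⟨a, show f a ∈ S.points from ha.symm ▸ p.2⟩, Set.mem_univ _, Subtype.ext ha⟩
  obtain ⟨C', hCO', hCX', hCY', hCI', hCg⟩ := exists_coordinatisation hOXY hOXI hOYI hXYI hOl hYl
    hg (Subtype.ext hf0) ⟨k, hXk, hIk, (Subtype.ext hf1 : g 1 = E).symm ▸ hEk⟩
  obtain ⟨F, hadd, hmul⟩ := C'.exists_field hS
  have key := SubConfiguration.coe_ptr_eq (C := C) (C' := C') rfl (by rw [hCO, hCO'])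
    (by rw [hCX, hCX']) (by rw [hCY, hCY']) (by rw [hCI, hCI']) (fun a => by rw [hCf, hCg])
  refine ⟨C, K, F, ?_, fun x y => ?_, fun x y => ?_⟩
  · rw [← hq, ← natCard_points_ne hYl]
    exact Nat.card_congr ((Equiv.Set.univ K).symm.trans hg.equiv)
  · rw [hadd]
    exact key 1 x y
  · rw [hmul]
    exact key x y 0
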